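/- **Theorem.** Let $\mathrm U$ be a countable relational structure with domain $U$ which is a *free amalgamation homogeneous structure*, that is: * every embedding of a finite induced substructure of $\mathrm U$ into $\mathrm U$ extends to an automorphism of $\mathrm U$; * the age of $\mathrm U$ (the class of all finite structures that embed into $\mathrm U$) is a free amalgamation age: it is closed under induced substructures, and a structure $\mathrm N$ belongs to it whenever $N$ is the union of two sets $M,M'$ such that $\mathrm N_{\downarrow M}$ and $\mathrm N_{\downarrow M'}$ belong to it and no tuple standing in a relation of $\mathrm N$ contains both an element of $M\setminus M'$ and an element of $M'\setminus M$. Let $\mathrm G$ be the group of automorphisms of $\mathrm U$ (not assumed to be transitive) and, for a finite $F\subseteq U$, let $\mathrm G_F$ be the pointwise stabilizer of $F$. A *type* with sockel $F$ is a pair $\langle F\mid x\rangle$ with $F\subseteq U$ finite and $x\in U\setminus F$, where $\langle F\mid x\rangle=\langle E\mid y\rangle$ if $F=E$ and $g(x)=y$ for some $g\in \mathrm G_F$. Its *typeset* is $\sigma(\langle F\mid x\rangle)=\{y\in U\setminus F : g(x)=y \text{ for some } g\in \mathrm G_F\}$. Let $\mathcal B=\{B_j : j<n\}$, $n\in\omega$,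 be a finite bundle: the $B_j$ are pairwise different types, all with the same sockel $\iota(\mathcal B)$. Put $\sigma(\mathcal B)=\bigcup_{j<n}\sigma(B_j)$. A *copy* of $\mathcal B$ is the image of a function $f:\iota(\mathcal B)\cup\sigma(\mathcal B)\to\iota(\mathcal B)\cup\sigma(\mathcal B)$ which agrees on every finite subset of $\iota(\mathcal B)\cup\sigma(\mathcal B)$ with some element of $\mathrm G_{\iota(\mathcal B)}$. For $S\subseteq\sigma(\mathcal B)$ let $$\overline{\boldsymbol\rho}(S)=\{A\subseteq\sigma(\mathcal B) : A \text{ is finite and } g[A]\subseteq S\text{ for some } g\in \mathrm G_{\iota(\mathcal B)}\}.$$ Then $\mathcal B$ is *weakly indivisible*, which means the following. Let $P=(P_{i,j};\,i\in\{0,1\},\,j<n)$ be any 2-colouring of $\mathcal B$, that is, the sets $P_{i,j}$ are pairwise disjoint and $P_{0,j}\cup P_{1,j}=\sigma(B_j)$ for every $j<n$. Then there are a set $J\subseteq\{0,\dots,n-1\}$, a function $\epsilon':\{0,\dots,n-1\}\to\{0,1\}$ and a copy $C$ of $\mathcal B$ such that 1. $C\cap\sigma(B_j)\subseteq P_{\epsilon'(j),j}$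 for every $j\in J$, and 2. for every function $\epsilon:\{0,\dots,n-1\}\to\{0,1\}$ which agrees with $\epsilon'$ on $J$, with $P_\epsilon=\bigcup_{j<n}P_{\epsilon(j),j}$, $$\overline{\boldsymbol\rho}(P_\epsilon\cap C)=\overline{\boldsymbol\rho}(\sigma(\mathcal B)).$$ -/

import Mathlib

open FirstOrder FirstOrder.Language CategoryTheory

universe u v w

namespace FreeAmalgamation

/-! ### Free amalgamation homogeneous structures -/

/-- Adjacency in the Gaifman graph of a relational structure `N`: the elements `a` and `b` are
different and are entries of a common tuple standing in one of the relations of `N`. -/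
def GaifmanAdj (L : FirstOrder.Language.{u, v}) {N : Type w} [L.Structure N] (a b : N) : Prop :=
  a ≠ b ∧ ∃ (k : ℕ) (R : L.Relations k) (x : Fin k → N),
    Structure.RelMap R x ∧ a ∈ Set.range x ∧ b ∈ Set.range x

/-- The structure `N` is the free amalgam of its induced substructures `M` and `M'` (over their
common part `B = M ∩ M'`): the domain of `N` is `M ∪ M'`, and no element of `C = M \ M'` is
adjacent in the Gaifman graph of `N` to an element of `C' = M' \ M`. -/
def IsFreeAmalgam {L : FirstOrder.Language.{u, v}} {N : Type w} [L.Structure N]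
    (M M' : L.Substructure N) : Prop :=
  (M : Set N) ∪ (M' : Set N) = Set.univ ∧
    ∀ x ∈ (M : Set N) \ M', ∀ y ∈ (M' : Set N) \ M, ¬ GaifmanAdj L x y

/-- A class `K` of structures is a free amalgamation age if it is closed under induced
substructures and contains the free amalgam of any two of its members (amalgamated over a common
induced substructure). -/
def IsFreeAmalgamationAge {L : FirstOrder.Language.{u, v}} (K : Set (Bundled.{w} L.Structure)) : Prop :=
  Hereditary K ∧
    ∀ (N : Type w) [L.Structure N] (M M' : L.Substructure N), IsFreeAmalgam M M' →
      (⟨M, inferInstance⟩ : Bundled.{w} L.Structure) ∈ K →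
      (⟨M', inferInstance⟩ : Bundled.{w} L.Structure) ∈ K →
      (⟨N, inferInstance⟩ : Bundled.{w} L.Structure) ∈ K

/-- A free amalgamation homogeneous structure: every embedding of a finite induced substructure
of `U` into `U` extends to an automorphism of `U`, and the age of `U`, that is the class of all
finite structures which embed into `U`, is a free amalgamation age. (In a relational language the
finitely generated structures of Mathlib's notions are the finite ones.) -/
structure IsFreeAmalgamationHomogeneous (L : FirstOrder.Language.{u, v}) (U : Type w) [L.Structure U] :
    Prop where
  homogeneous : L.IsUltrahomogeneous U
  age : IsFreeAmalgamationAge (L.age U)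

/-! ### Types -/

/-- The stabilizer `G_F`: the automorphisms of `U` that fix every element of `F`. -/
def stab (L : FirstOrder.Language.{u, v}) {U : Type w} [L.Structure U] (F : Finset U) : Set (U ≃[L] U) :=
  {g | ∀ a ∈ F, g a = a}

/-- A pair `⟨F | x⟩` with `F` a finite set and `x ∉ F`. -/
structure TypeRep (L : FirstOrder.Language.{u, v}) (U : Type w) [L.Structure U] where
  sockel : Finset U
  point : U
  point_notMem : point ∉ sockel

/-- The pairs `⟨F | x⟩` and `⟨E | y⟩` are equal as types if `F = E` and some `g ∈ G_F` maps `x`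
to `y`. -/
instance typeSetoid (L : FirstOrder.Language.{u, v}) (U : Type w) [L.Structure U] :
    Setoid (TypeRep L U) where
  r T S := T.sockel = S.sockel ∧ ∃ g ∈ stab L T.sockel, g T.point = S.point
  iseqv :=
    { refl := fun _ => ⟨rfl, Language.Equiv.refl L U, fun _ _ => rfl, rfl⟩
      symm := by
        rintro T S ⟨h, g, hg, hx⟩
        refine ⟨h.symm, g.symm, fun a ha => ?_, ?_⟩
        · have := hg a (h ▸ ha)
          conv_lhs => rw [← this]
          exact g.symm_apply_apply a
        · rw [← hx]
          exact g.symm_apply_apply _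
      trans := by
        rintro T S R ⟨h, g, hg, hx⟩ ⟨h', g', hg', hx'⟩
        refine ⟨h.trans h', g'.comp g, fun a ha => ?_, ?_⟩
        · rw [Language.Equiv.comp_apply, hg a ha, hg' a (h ▸ ha)]
        · rw [Language.Equiv.comp_apply, hx, hx'] }

/-- The types of the structure `U`. -/
def PointType (L : FirstOrder.Language.{u, v}) (U : Type w) [L.Structure U] : Type w :=
  Quotient (typeSetoid L U)

/-- The typeset of a pair `⟨F | x⟩`: the orbit of `x` under `G_F`, as a subset of `U \ F`. -/
def TypeRep.typeset {L : FirstOrder.Language.{u, v}} {U : Type w} [L.Structure U] (T : TypeRep L U) :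
    Set U :=
  {y | y ∉ T.sockel ∧ ∃ g ∈ stab L T.sockel, g T.point = y}

theorem TypeRep.typeset_subset_of_equiv {L : FirstOrder.Language.{u, v}} {U : Type w} [L.Structure U]
    {T S : TypeRep L U} (h : T ≈ S) : T.typeset ⊆ S.typeset := by
  rintro y ⟨hy, g, hg, rfl⟩
  obtain ⟨hs, k, hk, hkx⟩ := (typeSetoid L U).iseqv.symm h
  refine ⟨hs ▸ hy, g.comp k, fun a ha => ?_, ?_⟩
  · rw [Language.Equiv.comp_apply, hk a ha, hg a (hs ▸ ha)]
  · rw [Language.Equiv.comp_apply, hkx]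

/-- The sockel `ι(T)` of a type. -/
def PointType.sockel {L : FirstOrder.Language.{u, v}} {U : Type w} [L.Structure U] (T : PointType L U) :
    Finset U :=
  Quotient.lift (fun R : TypeRep L U => R.sockel)
    (fun R S (h : (typeSetoid L U).r R S) => h.1) T

/-- The typeset `σ(T)` of a type. -/
def PointType.typeset {L : FirstOrder.Language.{u, v}} {U : Type w} [L.Structure U] (T : PointType L U) :
    Set U :=
  Quotient.lift (fun R : TypeRep L U => R.typeset)
    (fun _ _ h => Set.Subset.antisymm (TypeRep.typeset_subset_of_equiv h)
      (TypeRep.typeset_subset_of_equiv ((typeSetoid L U).iseqv.symm h))) T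

/-! ### Finite bundles of types -/

/-- A finite bundle `{B_j | j ∈ n}`: pairwise different types `B_j`, all with the same sockel. -/
structure TypeBundle (L : FirstOrder.Language.{u, v}) (U : Type w) [L.Structure U] (n : ℕ) where
  sockel : Finset U
  type : Fin n → PointType L U
  sockel_type : ∀ j, (type j).sockel = sockel
  type_injective : Function.Injective type

namespace TypeBundle

variable {L : FirstOrder.Language.{u, v}} {U : Type w} [L.Structure U] {n : ℕ}

/-- `σ(𝓑)`, the union of the typesets of the types in the bundle. -/
def typeset (𝓑 : TypeBundle L U n) : Set U :=
  ⋃ j, (𝓑.type j).typeset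

/-- The set `ι(𝓑) ∪ σ(𝓑)`. -/
def domain (𝓑 : TypeBundle L U n) : Set U :=
  (𝓑.sockel : Set U) ∪ 𝓑.typeset

/-- A function `f` of `ι(𝓑) ∪ σ(𝓑)` to itself is an embedding of `𝓑` into `𝓑` if it agrees on
every finite set with an element of `G_{ι(𝓑)}`. -/
def IsEmbedding (𝓑 : TypeBundle L U n) (f : 𝓑.domain → 𝓑.domain) : Prop :=
  ∀ A : Finset 𝓑.domain, ∃ g ∈ stab L 𝓑.sockel, ∀ a ∈ A, g (a : U) = f a

/-- A copy of `𝓑` is the image of an embedding of `𝓑` into `𝓑`. -/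
def IsCopy (𝓑 : TypeBundle L U n) (C : Set U) : Prop :=
  ∃ f : 𝓑.domain → 𝓑.domain, 𝓑.IsEmbedding f ∧ C = Set.range fun x => (f x : U)

/-- The set of all finite `A ⊆ σ(𝓑)` that some element of `G_{ι(𝓑)}` maps into `S`. -/
def age (𝓑 : TypeBundle L U n) (S : Set U) : Set (Finset U) :=
  {A | (A : Set U) ⊆ 𝓑.typeset ∧ ∃ g ∈ stab L 𝓑.sockel, ∀ a ∈ A, g a ∈ S}

/-- `P = (P i j)` is a 2-colouring of `𝓑`: the sets `P i j` are pairwise disjoint, and the two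
sets `P 0 j` and `P 1 j` cover exactly the typeset of `B_j`. -/
structure IsTwoColouring (𝓑 : TypeBundle L U n) (P : Fin 2 → Fin n → Set U) : Prop where
  disjoint : ∀ i j i' j', ¬ (i = i' ∧ j = j') → P i j ∩ P i' j' = ∅
  cover : ∀ j, ⋃ i, P i j = (𝓑.type j).typeset

/-- The set `P_ε`, the union over `j` of the colour classes `P (ε j) j`. -/
def colourUnion (P : Fin 2 → Fin n → Set U) (ε : Fin n → Fin 2) : Set U :=
  ⋃ j, P (ε j) j

/-- The set `C` is `(J, ε')`-monochromatic: for every `j ∈ J` all elements of `C` in the typeset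
of `B_j` have the colour `ε' j`. -/
def IsMonochromatic (𝓑 : TypeBundle L U n) (P : Fin 2 → Fin n → Set U) (J : Set (Fin n))
    (ε' : Fin n → Fin 2) (C : Set U) : Prop :=
  ∀ j ∈ J, C ∩ (𝓑.type j).typeset ⊆ P (ε' j) j

/-- Weak indivisibility of a finite bundle. -/
def IsWeaklyIndivisible (𝓑 : TypeBundle L U n) : Prop :=
  ∀ P : Fin 2 → Fin n → Set U, 𝓑.IsTwoColouring P →
    ∃ (J : Set (Fin n)) (ε' : Fin n → Fin 2) (C : Set U),
      𝓑.IsCopy C ∧ 𝓑.IsMonochromatic P J ε' C ∧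
        ∀ ε : Fin n → Fin 2, (∀ j ∈ J, ε j = ε' j) →
          𝓑.age (colourUnion P ε ∩ C) = 𝓑.age 𝓑.typeset

end TypeBundle

end FreeAmalgamation

/-! Write F for the sockel. Choose J maximal such that some embedding f of the bundle makes σ(B_j)
monochromatic, of colour ε' j, for every j ∈ J; the copy C is the image of f. For j ∉ J and either
colour, maximality says that no further embedding h lets f ∘ h avoid that colour on σ(B_j).
`exists_blocking` turns this into local information. Fix a finite E and build h point by point,
keeping the image free from E over F and avoiding the colour. The construction must get stuck, and
where it does there is a finite D, free from E, and a type over F ∪ D all of whose realizations that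
together with D are free from E have the colour. `exists_equiv_of_blocking` uses these types to move
the points of a finite A one after another onto prescribed colours, with E collecting the sets D
already used. Free amalgamation keeps the points still to be treated free from E, so that the next
blocking type applies to them. -/

namespace FreeAmalgamation

open Structure

/-! ### Freeness of two sets over a third -/

section IsFree

variable {L : FirstOrder.Language.{u, v}} {U : Type w} [L.Structure U]

/-- The structure induced on `F ∪ P ∪ Q` is the free amalgam of those induced on `F ∪ P` and
`F ∪ Q`, where `F` is supposed to be disjoint from `P` and from `Q`. -/
def IsFree (L : FirstOrder.Language.{u, v}) {U : Type w} [L.Structure U] (F P Q : Set U) : Prop :=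
  Disjoint P Q ∧ ∀ (k : ℕ) (R : L.Relations k) (z : Fin k → U), RelMap R z →
    (∀ i, z i ∈ F ∪ P ∪ Q) → (∃ i, z i ∈ P) → (∃ i, z i ∈ Q) → False

theorem IsFree.mono {F F' P P' Q Q' : Set U} (h : IsFree L F P Q) (hP : P' ⊆ P) (hQ : Q' ⊆ Q)
    (hF : F' ⊆ F ∪ P ∪ Q) : IsFree L F' P' Q' := by
  refine ⟨h.1.mono hP hQ, fun k R z hR hz ⟨i, hi⟩ ⟨j, hj⟩ =>
    h.2 k R z hR (fun l => ?_) ⟨i, hP hi⟩ ⟨j, hQ hj⟩⟩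
  rcases hz l with (h1 | h1) | h1
  · exact hF h1
  · exact Or.inl (Or.inr (hP h1))
  · exact Or.inr (hQ h1)

theorem IsFree.image {F P Q : Set U} (h : IsFree L F P Q) (g : U ≃[L] U) :
    IsFree L (g '' F) (g '' P) (g '' Q) := by
  have key : ∀ (S : Set U) (x : U), x ∈ g '' S → g.symm x ∈ S := by
    rintro S _ ⟨y, hy, rfl⟩
    simpa using hy
  refine ⟨(Set.disjoint_image_iff g.injective).2 h.1, fun k R z hR hz ⟨i, hi⟩ ⟨j, hj⟩ =>
    h.2 k R (g.symm ∘ z) ((g.symm.map_rel R z).2 hR) (fun l => ?_) ⟨i, key _ _ hi⟩ ⟨j, key _ _ hj⟩⟩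
  rcases hz l with (h1 | h1) | h1
  · exact Or.inl (Or.inl (key _ _ h1))
  · exact Or.inl (Or.inr (key _ _ h1))
  · exact Or.inr (key _ _ h1)

end IsFree

/-! ### Partial isomorphisms obtained from homogeneity and free amalgams -/

section Homogeneity

variable {L : FirstOrder.Language.{u, v}} [L.IsRelational] {U : Type w} [L.Structure U]

/-- Ultrahomogeneity for maps given on a finite set. -/
theorem exists_equiv_eqOn (hU : L.IsUltrahomogeneous U) {S : Set U} (hS : S.Finite) (φ : U → U)
    (hinj : Set.InjOn φ S)
    (hrel : ∀ (k : ℕ) (R : L.Relations k) (z : Fin k → U), (∀ i, z i ∈ S) →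
      (RelMap R (φ ∘ z) ↔ RelMap R z)) :
    ∃ g : U ≃[L] U, ∀ s ∈ S, g s = φ s := by
  let T : L.Substructure U := ⟨S, fun {n} f => isEmptyElim f⟩
  have : Finite T := hS
  obtain ⟨g, hg⟩ := hU T Substructure.FG.of_finite
    { toFun := fun s => φ s
      inj' := fun a b h => Subtype.ext (hinj a.2 b.2 h)
      map_fun' := fun {n} f => isEmptyElim f
      map_rel' := fun R x => hrel _ R (fun i => (x i : U)) fun i => (x i).2 }
  exact ⟨g, fun s hs => (DFunLike.congr_fun hg (⟨s, hs⟩ : T)).symm⟩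

/-- The domain of the free amalgam over `B` of `B ∪ X` and `B ∪ Y`. -/
def AmalgamDomain {U : Type w} (B X Y : Set U) : Type w :=
  {p : U × Bool // (p.2 = false ∧ p.1 ∈ B ∪ Y) ∨ (p.2 = true ∧ p.1 ∈ X)}

namespace AmalgamDomain

variable (L) (B X Y : Set U)

/-- The points of the amalgam that come from `B ∪ X`. -/
def left : Set (AmalgamDomain B X Y) := {p | p.1.2 = true ∨ p.1.1 ∈ B}

/-- The points of the amalgam that come from `B ∪ Y`. -/
def right : Set (AmalgamDomain B X Y) := {p | p.1.2 = false}

/-- The tag in `Bool` separates X from Y even where they overlap in `U`. Relations hold only within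
one side, which makes the amalgam free. -/
instance : L.Structure (AmalgamDomain B X Y) where
  funMap f := isEmptyElim f
  RelMap R z := RelMap R (fun i => (z i).1.1) ∧
    ((∀ i, z i ∈ left B X Y) ∨ ∀ i, z i ∈ right B X Y)

theorem exists_embedding (hU : IsFreeAmalgamationHomogeneous L U) {B X Y : Set U} (hB : B.Finite)
    (hX : X.Finite) (hY : Y.Finite) (hXB : Disjoint X B) :
    Nonempty (AmalgamDomain B X Y ↪[L] U) := by
  let M : L.Substructure (AmalgamDomain B X Y) := ⟨left B X Y, fun {n} f => isEmptyElim f⟩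
  let M' : L.Substructure (AmalgamDomain B X Y) := ⟨right B X Y, fun {n} f => isEmptyElim f⟩
  have hfin : Finite (AmalgamDomain B X Y) := by
    refine Set.Finite.subset (((hB.union hY).union hX).prod (Set.finite_univ (α := Bool))) ?_
    rintro ⟨x, b⟩ (⟨-, h⟩ | ⟨-, h⟩)
    · exact ⟨Or.inl h, trivial⟩
    · exact ⟨Or.inr h, trivial⟩
  refine (hU.age.2 (AmalgamDomain B X Y) M M' ⟨?_, ?_⟩ ?_ ?_).2
  · ext p
    simp only [Set.mem_union, Set.mem_univ, iff_true]
    cases h : p.1.2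
    · exact Or.inr h
    · exact Or.inl (Or.inl h)
  · rintro x ⟨hx, hx'⟩ y ⟨hy, hy'⟩ ⟨-, k, R, z, ⟨-, hz⟩, ⟨i, rfl⟩, ⟨j, rfl⟩⟩
    rcases hz with hz | hz
    · exact hy' (hz j)
    · exact hx' (hz i)
  · refine ⟨Structure.FG.of_finite, ⟨⟨⟨fun p => p.1.1.1, ?_⟩, fun {n} f => isEmptyElim f, ?_⟩⟩⟩
    · rintro ⟨⟨⟨x, b⟩, hp⟩, hp'⟩ ⟨⟨⟨y, c⟩, hq⟩, hq'⟩ h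
      obtain rfl : x = y := h
      -- A point over B always has tag `false`, since X misses B; hence the left side projects
      -- injectively to `U`.
      have hb : b = c := by
        have hd : x ∈ X → x ∉ B := fun h => Set.disjoint_left.1 hXB h
        have e1 : b = true ∨ x ∈ B := hp'
        have e2 : c = true ∨ x ∈ B := hq'
        have e3 : b = true → x ∈ X := fun hb => by simpa [hb] using hp
        have e4 : c = true → x ∈ X := fun hc => by simpa [hc] using hq
        cases b <;> cases c <;> simp_all
      subst hb
      rfl
    · intro n R x
      exact ⟨fun h => ⟨h, Or.inl fun i => (x i).2⟩, fun h => h.1⟩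
  · refine ⟨Structure.FG.of_finite, ⟨⟨⟨fun p => p.1.1.1, ?_⟩, fun {n} f => isEmptyElim f, ?_⟩⟩⟩
    · rintro ⟨⟨⟨x, b⟩, hp⟩, hp'⟩ ⟨⟨⟨y, c⟩, hq⟩, hq'⟩ h
      obtain rfl : x = y := h
      obtain rfl : b = false := hp'
      obtain rfl : c = false := hq'
      rfl
    · intro n R x
      exact ⟨fun h => ⟨h, Or.inr fun i => (x i).2⟩, fun h => h.1⟩

end AmalgamDomain

/-- A finite set can be moved over `B` to a position that is free from a given finite set. -/
theorem exists_isFree_image (hU : IsFreeAmalgamationHomogeneous L U) {B X Y : Set U}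
    (hB : B.Finite) (hX : X.Finite) (hY : Y.Finite) (hXB : Disjoint X B) (hYB : Disjoint Y B) :
    ∃ g : U ≃[L] U, (∀ b ∈ B, g b = b) ∧ IsFree L B (g '' X) Y := by
  classical
  obtain ⟨e⟩ := AmalgamDomain.exists_embedding L hU hB hX hY hXB
  -- On a single side the projection to `U` preserves and reflects relations, so `e ∘ s` is a finite
  -- partial isomorphism of `U`. Below, α realizes the right side and β the left one, and the
  -- required automorphism is α⁻¹β.
  have extend : ∀ (S : Set U) (_ : S.Finite) (s : S → AmalgamDomain B X Y)
      (_ : ∀ x, (s x).1.1 = x)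
      (_ : (∀ x, s x ∈ AmalgamDomain.left B X Y) ∨ ∀ x, s x ∈ AmalgamDomain.right B X Y),
      ∃ g : U ≃[L] U, ∀ x : S, g x = e (s x) := by
    intro S hS s hs hlr
    refine (exists_equiv_eqOn hU.homogeneous hS
      (fun x => if h : x ∈ S then e (s ⟨x, h⟩) else x) ?_ ?_).imp
      fun g hg x => by simpa using hg x x.2
    · intro x hx y hy h
      simp only [hx, hy, dif_pos] at h
      simpa [hs] using congrArg (fun p => p.1.1) (e.injective h)
    · intro k R z hz
      have : (fun x => if h : x ∈ S then e (s ⟨x, h⟩) else x) ∘ z = e ∘ fun i => s ⟨z i, hz i⟩ := by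
        funext i
        simp [hz i]
      rw [this, e.map_rel]
      constructor
      · intro h
        simpa [hs] using h.1
      · intro h
        refine ⟨by simpa [hs] using h, ?_⟩
        exact hlr.imp (fun h i => h _) fun h i => h _
  obtain ⟨α, hα⟩ := extend (B ∪ Y) (hB.union hY) (fun x => ⟨(x, false), Or.inl ⟨rfl, x.2⟩⟩)
    (fun _ => rfl) (Or.inr fun _ => rfl)
  obtain ⟨β, hβ⟩ := extend (B ∪ X) (hB.union hX)
    (fun x => ⟨(x, decide (x.1 ∉ B)), by
      by_cases h : x.1 ∈ B
      · exact Or.inl ⟨by simp [h], Or.inl h⟩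
      · exact Or.inr ⟨by simp [h], x.2.resolve_left h⟩⟩)
    (fun _ => rfl)
    (Or.inl fun x => by
      by_cases h : x.1 ∈ B
      · exact Or.inr h
      · exact Or.inl (by simp [h]))
  have hαB : ∀ y (hy : y ∈ B ∪ Y), α.symm (e ⟨(y, false), Or.inl ⟨rfl, hy⟩⟩) = y := by
    intro y hy
    rw [← hα ⟨y, hy⟩]
    exact α.symm_apply_apply y
  have hβB : ∀ b (hb : b ∈ B), β b = e ⟨(b, false), Or.inl ⟨rfl, Or.inl hb⟩⟩ := by
    intro b hb
    rw [hβ ⟨b, Or.inl hb⟩]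
    simp [hb]
  have hβX : ∀ x (hx : x ∈ X), β x = e ⟨(x, true), Or.inr ⟨rfl, hx⟩⟩ := by
    intro x hx
    rw [hβ ⟨x, Or.inr hx⟩]
    simp [Set.disjoint_left.1 hXB hx]
  have hgX : ∀ y, y ∈ α.symm.comp β '' X → ∃ p : AmalgamDomain B X Y, α y = e p ∧ p.1.2 = true ∧
      p.1.1 ∈ X := by
    rintro _ ⟨x, hx, rfl⟩
    refine ⟨⟨(x, true), Or.inr ⟨rfl, hx⟩⟩, ?_, rfl, hx⟩
    rw [Language.Equiv.comp_apply, Language.Equiv.apply_symm_apply, hβX x hx]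
  refine ⟨α.symm.comp β, fun b hb => ?_, Set.disjoint_left.2 fun y hy hyY => ?_, ?_⟩
  · rw [Language.Equiv.comp_apply, hβB b hb, hαB b (Or.inl hb)]
  · obtain ⟨p, hp, hp2, -⟩ := hgX y hy
    rw [hα ⟨y, Or.inr hyY⟩] at hp
    rw [← e.injective hp] at hp2
    simp at hp2
  · rintro k R z hR hz ⟨i, hi⟩ ⟨j, hj⟩
    have hz' : ∀ l, ∃ p : AmalgamDomain B X Y, α (z l) = e p := by
      intro l
      rcases hz l with (h | h) | h
      · exact ⟨_, hα ⟨_, Or.inl h⟩⟩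
      · exact ⟨_, (hgX _ h).choose_spec.1⟩
      · exact ⟨_, hα ⟨_, Or.inr h⟩⟩
    choose p hp using hz'
    -- Pulled back along `e`, the tuple must lie on one side: its entry from X excludes the right,
    -- its entry from Y the left.
    have hR' : RelMap R p := by
      rw [← e.map_rel, show e ∘ p = α ∘ z from funext fun l => (hp l).symm, α.map_rel]
      exact hR
    obtain ⟨q, hq, hq2, hqX⟩ := hgX _ hi
    rcases hR'.2 with h | h
    · have hj' := hα ⟨z j, Or.inr hj⟩
      rw [hp j] at hj'
      have := h j
      rw [e.injective hj'] at this
      exact Set.disjoint_left.1 hYB hj (this.resolve_left (by simp))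
    · have := h i
      rw [hp i] at hq
      rw [e.injective hq] at this
      exact absurd (hq2.symm.trans this) (by simp)

/-- A map that is the identity on `F ∪ E` and agrees on `D` with some `m ∈ G_F` is a partial
isomorphism if both `D` and its image are free from `E` over `F`. -/
theorem exists_equiv_of_isFree (hU : L.IsUltrahomogeneous U) {F E D : Set U} (hF : F.Finite)
    (hE : E.Finite) (hD : D.Finite) (m : U ≃[L] U) (hm : ∀ a ∈ F, m a = a) (hDF : Disjoint D F)
    (h : IsFree L F D E) (h' : IsFree L F (m '' D) E) :
    ∃ k : U ≃[L] U, (∀ a ∈ F, k a = a) ∧ (∀ a ∈ E, k a = a) ∧ ∀ a ∈ D, k a = m a := by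
  classical
  have hmF : ∀ x ∈ D, m x ∉ F := by
    intro x hx hxF
    rw [← m.injective (hm _ hxF)] at hx
    exact Set.disjoint_left.1 hDF hx hxF
  suffices ∃ k : U ≃[L] U, ∀ x ∈ F ∪ D ∪ E, k x = if x ∈ D then m x else x by
    obtain ⟨k, hk⟩ := this
    refine ⟨k, fun a ha => ?_, fun a ha => ?_, fun a ha => ?_⟩
    · simpa [Set.disjoint_right.1 hDF ha] using hk a (Or.inl (Or.inl ha))
    · simpa [Set.disjoint_right.1 h.1 ha] using hk a (Or.inr ha)
    · simpa [ha] using hk a (Or.inl (Or.inr ha))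
  refine exists_equiv_eqOn hU ((hF.union hD).union hE) (fun x => if x ∈ D then m x else x) ?_ ?_
  · have aux : ∀ x ∈ D, ∀ y ∈ F ∪ D ∪ E, y ∉ D → m x ≠ y := by
      rintro x hx y ((hy | hy) | hy) hyD rfl
      · exact hmF x hx hy
      · exact hyD hy
      · exact Set.disjoint_left.1 h'.1 ⟨x, hx, rfl⟩ hy
    intro x hx y hy hxy
    by_cases hxD : x ∈ D <;> by_cases hyD : y ∈ D <;> simp only [hxD, hyD, if_true, if_false] at hxy
    · exact m.injective hxy
    · exact (aux x hxD y hy hyD hxy).elim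
    · exact (aux y hyD x hx hxD hxy.symm).elim
    · exact hxy
  · intro j R z hz
    -- Tuples meeting both D and E are unrelated before and after the map, by the two freeness
    -- assumptions. On any other tuple the map is `m` or the identity.
    by_cases hzD : ∃ i, z i ∈ D
    · by_cases hzE : ∃ i, z i ∈ E
      · refine iff_of_false (fun hR => h'.2 j R _ hR (fun l => ?_) ?_ ?_)
          fun hR => h.2 j R z hR hz hzD hzE
        · by_cases hl : z l ∈ D
          · simp [hl]
          · rcases hz l with (h1 | h1) | h1
            · simp [hl, h1]
            · exact (hl h1).elim
            · simp [hl, h1]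
        · obtain ⟨i, hi⟩ := hzD
          exact ⟨i, z i, hi, by simp [hi]⟩
        · obtain ⟨i, hi⟩ := hzE
          exact ⟨i, by simpa [Set.disjoint_right.1 h.1 hi] using hi⟩
      · rw [show (fun x => if x ∈ D then m x else x) ∘ z = m ∘ z from ?_, m.map_rel]
        funext l
        rcases hz l with (h1 | h1) | h1
        · simp [hm _ h1]
        · simp [h1]
        · exact (hzE ⟨l, h1⟩).elim
    · rw [show (fun x => if x ∈ D then m x else x) ∘ z = z from ?_]
      funext l
      simp [not_exists.1 hzD l]

end Homogeneity

/-! ### Limits of chains of automorphisms -/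

section Chain

variable {L : FirstOrder.Language.{u, v}} {U : Type w} [L.Structure U]

/-- The limit of a chain of automorphisms which agree on growing sets that exhaust `V`. -/
theorem exists_limit_of_extension [Countable U] {V : Set U} (Good : Set U → (U ≃[L] U) → Prop)
    (hGood : Good ∅ (Language.Equiv.refl L U))
    (hext : ∀ S g, Good S g → ∀ v ∈ V, ∃ S' g', S ⊆ S' ∧ v ∈ S' ∧ Good S' g' ∧
      ∀ s ∈ S, g' s = g s) :
    ∃ f : U → U, ∀ A : Set U, A.Finite → A ⊆ V →
      ∃ S g, A ⊆ S ∧ Good S g ∧ ∀ a ∈ A, g a = f a := by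
  classical
  rcases V.eq_empty_or_nonempty with rfl | hV
  · exact ⟨id, fun A _ hA => ⟨∅, _, hA, hGood, fun a ha => (hA ha).elim⟩⟩
  obtain ⟨v, rfl⟩ := (Set.to_countable V).exists_eq_range hV
  choose! S' g' hsub hmem hgood hagree using hext
  let p : ℕ → Set U × (U ≃[L] U) := fun k =>
    Nat.rec (∅, Language.Equiv.refl L U) (fun i q => (S' q.1 q.2 (v i), g' q.1 q.2 (v i))) k
  have hp : ∀ k, Good (p k).1 (p k).2 := by
    intro k
    induction k with
    | zero => exact hGood
    | succ k ih => exact hgood _ _ ih _ ⟨k, rfl⟩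
  have hmono : Monotone fun k => (p k).1 :=
    monotone_nat_of_le_succ fun k => hsub _ _ (hp k) _ ⟨k, rfl⟩
  have hstep : ∀ k l, k ≤ l → ∀ s ∈ (p k).1, (p l).2 s = (p k).2 s := by
    intro k l hkl s hs
    induction l, hkl using Nat.le_induction with
    | base => rfl
    | succ l hkl ih => exact (hagree _ _ (hp l) _ ⟨l, rfl⟩ s (hmono hkl hs)).trans ih
  -- The value at x is frozen at the first stage containing x. The limit need not be surjective, so
  -- no backward steps occur in the chain.
  refine ⟨fun x => if h : ∃ k, x ∈ (p k).1 then (p (Nat.find h)).2 x else x, fun A hA hAV => ?_⟩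
  have hbound : ∃ N, A ⊆ (p N).1 := by
    induction A, hA using Set.Finite.induction_on with
    | empty => exact ⟨0, Set.empty_subset _⟩
    | @insert a s _ _ ih =>
      obtain ⟨N, hN⟩ := ih ((Set.subset_insert _ _).trans hAV)
      obtain ⟨i, rfl⟩ := hAV (Set.mem_insert _ _)
      refine ⟨max N (i + 1), Set.insert_subset ?_ (hN.trans (hmono (le_max_left _ _)))⟩
      exact hmono (le_max_right _ _) (hmem _ _ (hp i) _ ⟨i, rfl⟩)
  obtain ⟨N, hN⟩ := hbound
  refine ⟨_, _, hN, hp N, fun a ha => ?_⟩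
  have h : ∃ k, a ∈ (p k).1 := ⟨N, hN ha⟩
  simp only [dif_pos h]
  exact hstep _ _ (Nat.find_min' h (hN ha)) a (Nat.find_spec h)

end Chain

/-! ### Blocking types and their successive realization -/

section Blocking

variable {L : FirstOrder.Language.{u, v}} [L.IsRelational] {U : Type w} [L.Structure U]

theorem image_eq_self_of_forall {g : U → U} {S : Set U} (h : ∀ s ∈ S, g s = s) :
    g '' S = S :=
  (Set.image_congr h).trans (Set.image_id' S)

/-- If no limit of automorphisms in `G_F` maps the elements of `W` to elements without the
property `c`, then over some finite set free from `E` there is a type of an element of `W` all of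
whose realizations free from `E` have the property `c`. -/
theorem exists_blocking [Countable U] (hU : IsFreeAmalgamationHomogeneous L U) {F V W : Set U}
    (hF : F.Finite) (hVF : Disjoint V F)
    (hV : ∀ g : U ≃[L] U, (∀ a ∈ F, g a = a) → ∀ x ∈ V, g x ∈ V) (hWV : W ⊆ V) (c : U → Prop)
    (hno : ¬ ∃ f : U → U, (∀ A : Set U, A.Finite → A ⊆ V →
      ∃ g : U ≃[L] U, (∀ a ∈ F, g a = a) ∧ ∀ a ∈ A, g a = f a) ∧ ∀ x ∈ W, ¬ c (f x))
    {E : Set U} (hE : E.Finite) (hEF : Disjoint E F) :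
    ∃ D : Set U, D.Finite ∧ Disjoint D F ∧ IsFree L F D E ∧ ∃ x ∈ W, ∃ m : U ≃[L] U,
      (∀ a ∈ F, m a = a) ∧ m x ∉ D ∧ ∀ k : U ≃[L] U, (∀ a ∈ F, k a = a) → (∀ d ∈ D, k d = d) →
        IsFree L F (insert (k (m x)) D) E → c (k (m x)) := by
  by_contra hcon
  apply hno
  let Good : Set U → (U ≃[L] U) → Prop := fun S g => S.Finite ∧ S ⊆ V ∧ (∀ a ∈ F, g a = a) ∧
    IsFree L F (g '' S) E ∧ ∀ x ∈ S, x ∈ W → ¬ c (g x)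
  suffices ∃ f : U → U, ∀ A : Set U, A.Finite → A ⊆ V →
      ∃ S g, A ⊆ S ∧ Good S g ∧ ∀ a ∈ A, g a = f a by
    obtain ⟨f, hf⟩ := this
    refine ⟨f, fun A hA hAV => ?_, fun x hx => ?_⟩
    · obtain ⟨S, g, -, ⟨-, -, hg, -⟩, h⟩ := hf A hA hAV
      exact ⟨g, hg, h⟩
    · obtain ⟨S, g, hS, ⟨-, -, -, -, hg⟩, h⟩ := hf {x} (Set.finite_singleton x)
        (Set.singleton_subset_iff.2 (hWV hx))
      rw [← h x rfl]
      exact hg x (hS rfl) hx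
  refine exists_limit_of_extension Good ?_ ?_
  · refine ⟨Set.finite_empty, Set.empty_subset _, fun _ _ => rfl, ⟨by simp, ?_⟩, by simp⟩
    rintro k R z - - ⟨i, hi⟩
    simp at hi
  · rintro S g ⟨hS, hSV, hg, hfree, hc⟩ x hx
    by_cases hxS : x ∈ S
    · exact ⟨S, g, subset_rfl, hxS, ⟨hS, hSV, hg, hfree, hc⟩, fun _ _ => rfl⟩
    have hgS : g x ∉ g '' S := fun ⟨y, hy, hyx⟩ => hxS (g.injective hyx ▸ hy)
    have hDF : Disjoint (g '' S) F := by
      refine Set.disjoint_left.2 ?_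
      rintro _ ⟨y, hy, rfl⟩ hyF
      exact Set.disjoint_left.1 hVF (hV g hg y (hSV hy)) hyF
    suffices ∃ k : U ≃[L] U, (∀ a ∈ F, k a = a) ∧ (∀ d ∈ g '' S, k d = d) ∧
        IsFree L F (insert (k (g x)) (g '' S)) E ∧ (x ∈ W → ¬ c (k (g x))) by
      obtain ⟨k, hkF, hkS, hk, hkc⟩ := this
      have hkg : ∀ s ∈ S, (k.comp g) s = g s := fun s hs => hkS _ ⟨s, hs, rfl⟩
      refine ⟨insert x S, k.comp g, Set.subset_insert _ _, Set.mem_insert _ _,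
        ⟨hS.insert x, Set.insert_subset hx hSV, fun a ha => ?_, ?_, ?_⟩, hkg⟩
      · rw [Language.Equiv.comp_apply, hg a ha, hkF a ha]
      · rwa [Set.image_insert_eq, Set.image_congr hkg, Language.Equiv.comp_apply]
      · rintro y (rfl | hy) hyW
        · exact hkc hyW
        · rw [hkg y hy]
          exact hc y hy hyW
    by_cases hxW : x ∈ W
    -- If no extension to x ∈ W avoids c, then D = `g '' S` and m = g form exactly the blocking
    -- configuration excluded by `hcon`.
    · by_contra hk
      refine hcon ⟨g '' S, hS.image g, hDF, hfree, x, hxW, g, hg, hgS, fun k hkF hkD hkE => ?_⟩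
      by_contra hck
      exact hk ⟨k, hkF, hkD, hkE, fun _ => hck⟩
    -- Outside W only freeness matters: g x is moved over F ∪ `g '' S` to be free from E.
    · have hdisj : Disjoint {g x} (F ∪ g '' S) := by
        rw [Set.disjoint_singleton_left]
        rintro (h | h)
        · exact Set.disjoint_left.1 hVF (hV g hg x hx) h
        · exact hgS h
      obtain ⟨k, hkB, hk⟩ := exists_isFree_image hU (hF.union (hS.image g))
        (Set.finite_singleton (g x)) hE hdisj (Set.disjoint_union_right.2 ⟨hEF, hfree.1.symm⟩)
      refine ⟨k, fun a ha => hkB a (Or.inl ha), fun a ha => hkB a (Or.inr ha), ⟨?_, ?_⟩,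
        fun h => (hxW h).elim⟩
      · rw [Set.disjoint_insert_left]
        exact ⟨Set.disjoint_left.1 hk.1 ⟨_, rfl, rfl⟩, hfree.1⟩
      · intro l R z hR hz hzD hzE
        by_cases hkx : ∃ i, z i = k (g x)
        · refine hk.2 l R z hR (fun i => ?_) (hkx.imp fun i hi => ⟨_, rfl, hi.symm⟩) hzE
          rcases hz i with (h | h | h) | h
          · exact Or.inl (Or.inl (Or.inl h))
          · exact Or.inl (Or.inr ⟨_, rfl, h.symm⟩)
          · exact Or.inl (Or.inl (Or.inr h))
          · exact Or.inr h
        · rw [not_exists] at hkx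
          refine hfree.2 l R z hR (fun i => ?_)
            (hzD.imp fun i hi => hi.resolve_left (hkx i)) hzE
          rcases hz i with (h | h | h) | h
          · exact Or.inl (Or.inl h)
          · exact (hkx i h).elim
          · exact Or.inl (Or.inr h)
          · exact Or.inr h

/-- A finite set can be moved by an element of `G_F` so that each of its elements `a` acquires the
property `c a`, if these properties are forced by types over finite sets free from any given finite
set. -/
theorem exists_equiv_of_blocking (hU : IsFreeAmalgamationHomogeneous L U) {F A : Set U}
    (hF : F.Finite) (hA : A.Finite) (hAF : Disjoint A F) (c : U → U → Prop)
    (hblock : ∀ a ∈ A, ∀ E : Set U, E.Finite → Disjoint E F →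
      ∃ D : Set U, D.Finite ∧ Disjoint D F ∧ IsFree L F D E ∧ ∃ m : U ≃[L] U,
        (∀ x ∈ F, m x = x) ∧ m a ∉ D ∧ ∀ k : U ≃[L] U, (∀ x ∈ F, k x = x) → (∀ d ∈ D, k d = d) →
          IsFree L F (insert (k (m a)) D) E → c a (k (m a))) :
    ∃ g : U ≃[L] U, (∀ x ∈ F, g x = x) ∧ ∀ a ∈ A, c a (g a) := by
  -- Invariant for the treated part A₁: its properties survive every automorphism fixing F ∪ E, and
  -- the images of the untreated points are free from E.
  suffices ∃ E : Set U, E.Finite ∧ Disjoint E F ∧ ∃ g : U ≃[L] U, (∀ x ∈ F, g x = x) ∧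
      IsFree L F (g '' (A \ A)) E ∧ ∀ k : U ≃[L] U, (∀ x ∈ F, k x = x) → (∀ e ∈ E, k e = e) →
        ∀ a ∈ A, c a (k (g a)) by
    obtain ⟨E, -, -, g, hg, -, h⟩ := this
    exact ⟨g, hg, h (Language.Equiv.refl L U) (fun _ _ => rfl) fun _ _ => rfl⟩
  refine Set.Finite.induction_on_subset (motive := fun A₁ _ => ∃ E : Set U, E.Finite ∧
    Disjoint E F ∧ ∃ g : U ≃[L] U, (∀ x ∈ F, g x = x) ∧ IsFree L F (g '' (A \ A₁)) E ∧
      ∀ k : U ≃[L] U, (∀ x ∈ F, k x = x) → (∀ e ∈ E, k e = e) → ∀ a ∈ A₁, c a (k (g a))) A hA ?_ ?_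
  · refine ⟨∅, Set.finite_empty, by simp, Language.Equiv.refl L U, fun _ _ => rfl, ⟨by simp, ?_⟩,
      by simp⟩
    rintro k R z - - - ⟨i, hi⟩
    exact hi
  rintro a A₁ haA - haA₁ ⟨E, hE, hEF, g, hg, hfree, hc⟩
  obtain ⟨D, hD, hDF, hDE, m, hm, hmD, hmc⟩ := hblock a haA E hE hEF
  set Y := g '' (A \ insert a A₁) with hY
  have hYA : Y ⊆ g '' (A \ A₁) :=
    Set.image_mono (Set.sdiff_subset_sdiff_right (Set.subset_insert _ _))
  have hYfin : Y.Finite := (hA.sdiff).image g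
  have hgaA : g a ∈ g '' (A \ A₁) := ⟨a, ⟨haA, haA₁⟩, rfl⟩
  have hgaY : g a ∉ Y := by
    rintro ⟨b, hb, hba⟩
    exact hb.2 (Or.inl (g.injective hba))
  have hgF : ∀ b ∈ A, g b ∉ F := by
    intro b hb hbF
    rw [← g.injective (hg _ hbF)] at hb
    exact Set.disjoint_left.1 hAF hb hbF
  have hgaE : g a ∉ E := Set.disjoint_left.1 hfree.1 hgaA
  have hYF : Disjoint Y F := by
    refine Set.disjoint_left.2 ?_
    rintro _ ⟨b, hb, rfl⟩
    exact hgF b hb.1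
  have symm_fix : ∀ (h : U ≃[L] U) (S : Set U), (∀ x ∈ S, h x = x) → ∀ x ∈ S, h.symm x = x := by
    intro h S hS x hx
    conv_lhs => rw [← hS x hx]
    exact h.symm_apply_apply x
  have hXB : Disjoint (g.comp m.symm '' D) (insert (g a) F) := by
    rw [Set.disjoint_insert_right]
    constructor
    · rintro ⟨d, hd, hda⟩
      apply hmD
      have : m.symm d = a := g.injective hda
      rw [← this, m.apply_symm_apply]
      exact hd
    · refine Set.disjoint_left.2 ?_
      rintro _ ⟨d, hd, rfl⟩ hdF
      have h1 : m.symm d ∈ F := by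
        have : g (m.symm d) ∈ F := hdF
        rwa [g.injective (hg _ this)] at this
      have h2 : d ∈ F := by
        have := hm _ h1
        rw [m.apply_symm_apply] at this
        rwa [this]
      exact Set.disjoint_left.1 hDF hd h2
  have hYB : Disjoint (E ∪ Y) (insert (g a) F) := by
    rw [Set.disjoint_insert_right]
    exact ⟨fun h => h.elim hgaE hgaY, Set.disjoint_union_left.2 ⟨hEF, hYF⟩⟩
  -- The set g m⁻¹ D lies over g a as D lies over m a. It is moved, with g a fixed, away from E and
  -- the remaining points Y.
  obtain ⟨γ, hγB, hγ⟩ := exists_isFree_image hU (hF.insert (g a)) (hD.image _) (hE.union hYfin)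
    hXB hYB
  set D' := γ '' (g.comp m.symm '' D) with hD'
  let m₀ : U ≃[L] U := m.comp (g.symm.comp γ.symm)
  have hγa : γ (g a) = g a := hγB _ (Set.mem_insert _ _)
  have hγF : ∀ x ∈ F, γ x = x := fun x hx => hγB x (Set.mem_insert_of_mem _ hx)
  have hm₀D : ∀ d, m₀ (γ (g.comp m.symm d)) = d := by
    intro d
    simp [m₀, Language.Equiv.comp_apply]
  have hm₀F : ∀ x ∈ F, m₀ x = x := by
    intro x hx
    simp [m₀, Language.Equiv.comp_apply, symm_fix γ F hγF x hx, symm_fix g F hg x hx, hm x hx]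
  have hm₀a : m₀ (g a) = m a := by
    have : γ.symm (g a) = g a := by
      conv_lhs => rw [← hγa]
      exact γ.symm_apply_apply _
    simp [m₀, Language.Equiv.comp_apply, this]
  have hm₀image : m₀ '' D' = D := by
    rw [hD', Set.image_image, Set.image_image]
    exact (Set.image_congr fun d _ => hm₀D d).trans (Set.image_id' D)
  have hD'fin : D'.Finite := (hD.image _).image _
  have hD'E : IsFree L F D' E :=
    hγ.mono subset_rfl Set.subset_union_left fun x hx => Or.inl (Or.inl (Or.inr hx))
  have hD'F : Disjoint D' F := by
    refine Set.disjoint_left.2 fun x hx hxF => ?_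
    have : m₀ x ∈ D := hm₀image ▸ ⟨x, hx, rfl⟩
    rw [hm₀F x hxF] at this
    exact Set.disjoint_left.1 hDF this hxF
  -- Both D' and D are free from E, so D' can be carried back to D without disturbing E. Then k (g
  -- a) realizes the blocking type over F ∪ D.
  obtain ⟨k, hkF, hkE, hkD'⟩ := exists_equiv_of_isFree hU.homogeneous hF hE hD'fin m₀ hm₀F hD'F
    hD'E (by rwa [hm₀image])
  have hkD'image : k '' D' = D := (Set.image_congr hkD').trans hm₀image
  refine ⟨E ∪ D, hE.union hD, Set.disjoint_union_left.2 ⟨hEF, hDF⟩, k.comp g, ?_, ?_, ?_⟩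
  · intro x hx
    rw [Language.Equiv.comp_apply, hg x hx, hkF x hx]
  -- Tuples meeting D' are excluded by the choice of γ, the others by the induction hypothesis.
  · have h : IsFree L F Y (E ∪ D') := by
      refine ⟨Set.disjoint_union_right.2 ⟨hfree.1.mono_left hYA,
        (hγ.1.mono_right Set.subset_union_right).symm⟩, fun l R z hR hz hzY hzE => ?_⟩
      by_cases hzD' : ∃ i, z i ∈ D'
      · refine hγ.2 l R z hR (fun i => ?_) hzD' (hzY.imp fun i hi => Or.inr hi)
        rcases hz i with (h | h) | h | h
        · exact Or.inl (Or.inl (Or.inr h))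
        · exact Or.inr (Or.inr h)
        · exact Or.inr (Or.inl h)
        · exact Or.inl (Or.inr h)
      · rw [not_exists] at hzD'
        refine hfree.2 l R z hR (fun i => ?_) (hzY.imp fun i hi => hYA hi)
          (hzE.imp fun i hi => hi.resolve_right (hzD' i))
        rcases hz i with (h | h) | h | h
        · exact Or.inl (Or.inl h)
        · exact Or.inl (Or.inr (hYA h))
        · exact Or.inr h
        · exact (hzD' i h).elim
    have h' := h.image k
    rw [image_eq_self_of_forall hkF, Set.image_union, image_eq_self_of_forall hkE, hkD'image, hY,
      Set.image_image] at h'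
    exact h'
  · intro k' hk'F hk'E b hb
    have hk'k : ∀ x ∈ F, k'.comp k x = x := fun x hx => by
      rw [Language.Equiv.comp_apply, hkF x hx, hk'F x hx]
    rcases hb with rfl | hb
    -- This composite fixes D pointwise, as m₀⁻¹ takes D to D' and k reverses it; it sends the
    -- blocking point to the point under consideration.
    · have key := hmc ((k'.comp k).comp m₀.symm) (fun x hx => ?_) (fun d hd => ?_)
      · have hma : ((k'.comp k).comp m₀.symm) (m b) = k' (k.comp g b) := by
          rw [← hm₀a, Language.Equiv.comp_apply, Language.Equiv.symm_apply_apply]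
          rfl
        rw [hma] at key
        apply key
        have h : IsFree L F (insert (g b) D') E := by
          refine ⟨Set.disjoint_insert_left.2 ⟨hgaE, hD'E.1⟩, fun l R z hR hz hzD hzE => ?_⟩
          by_cases hzD' : ∃ i, z i ∈ D'
          · refine hγ.2 l R z hR (fun i => ?_) hzD' (hzE.imp fun i hi => Or.inl hi)
            rcases hz i with (h | h | h) | h
            · exact Or.inl (Or.inl (Or.inr h))
            · exact Or.inl (Or.inl (Or.inl h))
            · exact Or.inl (Or.inr h)
            · exact Or.inr (Or.inl h)
          · rw [not_exists] at hzD'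
            have hzg : ∀ i, z i ∈ insert (g b) D' → z i ∈ g '' (A \ A₁) := fun i hi =>
              (hi.resolve_right (hzD' i)).symm ▸ hgaA
            refine hfree.2 l R z hR (fun i => ?_) (hzD.imp hzg) hzE
            rcases hz i with (h | h) | h
            · exact Or.inl (Or.inl h)
            · exact Or.inl (Or.inr (hzg i h))
            · exact Or.inr h
        have h' := (h.image k).image k'
        rwa [image_eq_self_of_forall hkF, image_eq_self_of_forall hk'F, Set.image_insert_eq,
          Set.image_insert_eq, hkD'image,
          image_eq_self_of_forall fun d hd => hk'E d (Or.inr hd), image_eq_self_of_forall hkE,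
          image_eq_self_of_forall fun d hd => hk'E d (Or.inl hd)] at h'
      · rw [Language.Equiv.comp_apply, symm_fix m₀ F hm₀F x hx, hk'k x hx]
      · have h1 : m₀.symm d = γ (g.comp m.symm d) := by
          conv_lhs => rw [← hm₀D d]
          exact m₀.symm_apply_apply _
        rw [Language.Equiv.comp_apply, h1, Language.Equiv.comp_apply,
          hkD' _ ⟨_, ⟨d, hd, rfl⟩, rfl⟩, hm₀D, hk'E d (Or.inr hd)]
    · exact hc (k'.comp k) hk'k (fun e he => by
        rw [Language.Equiv.comp_apply, hkE e he, hk'E e (Or.inl he)]) b hb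

end Blocking

/-! ### Typesets as orbits of the stabilizer -/

namespace PointType

variable {L : FirstOrder.Language.{u, v}} {U : Type w} [L.Structure U]

theorem disjoint_typeset_sockel (T : PointType L U) : Disjoint T.typeset (T.sockel : Set U) := by
  induction T using Quotient.inductionOn with
  | h R => exact Set.disjoint_left.2 fun x hx => hx.1

theorem apply_mem_typeset (T : PointType L U) {g : U ≃[L] U} (hg : g ∈ stab L T.sockel) {x : U}
    (hx : x ∈ T.typeset) : g x ∈ T.typeset := by
  induction T using Quotient.inductionOn with
  | h R =>
    obtain ⟨hxR, k, hk, rfl⟩ := hx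
    refine ⟨fun h => hxR ?_, g.comp k, fun a ha => ?_, rfl⟩
    · rwa [← g.injective (hg _ h)]
    · rw [Language.Equiv.comp_apply, hk a ha]
      exact hg a ha

theorem exists_apply_eq (T : PointType L U) {x y : U} (hx : x ∈ T.typeset) (hy : y ∈ T.typeset) :
    ∃ g ∈ stab L T.sockel, g x = y := by
  induction T using Quotient.inductionOn with
  | h R =>
    obtain ⟨-, k, hk, rfl⟩ := hx
    obtain ⟨-, m, hm, rfl⟩ := hy
    refine ⟨m.comp k.symm, fun a ha => ?_, ?_⟩
    · have : k.symm a = a := by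
        conv_lhs => rw [← hk a ha]
        exact k.symm_apply_apply a
      rw [Language.Equiv.comp_apply, this, hm a ha]
    · rw [Language.Equiv.comp_apply, Language.Equiv.symm_apply_apply]

end PointType

/-! ### Embeddings of bundles and weak indivisibility -/

namespace TypeBundle

variable {L : FirstOrder.Language.{u, v}} {U : Type w} [L.Structure U] {n : ℕ}
  (𝓑 : TypeBundle L U n)

theorem apply_mem_typeset_type {g : U ≃[L] U} (hg : g ∈ stab L 𝓑.sockel) {x : U} {j : Fin n}
    (hx : x ∈ (𝓑.type j).typeset) : g x ∈ (𝓑.type j).typeset :=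
  (𝓑.type j).apply_mem_typeset (by rwa [𝓑.sockel_type]) hx

theorem symm_mem_stab {F : Finset U} {g : U ≃[L] U} (hg : g ∈ stab L F) : g.symm ∈ stab L F := by
  intro a ha
  conv_lhs => rw [← hg a ha]
  exact g.symm_apply_apply a

theorem mem_typeset_type_of_apply_mem {g : U ≃[L] U} (hg : g ∈ stab L 𝓑.sockel) {x : U} {j : Fin n}
    (hx : g x ∈ (𝓑.type j).typeset) : x ∈ (𝓑.type j).typeset := by
  simpa using 𝓑.apply_mem_typeset_type (symm_mem_stab hg) hx

theorem typeset_type_subset (j : Fin n) : (𝓑.type j).typeset ⊆ 𝓑.typeset :=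
  Set.subset_iUnion (fun j => (𝓑.type j).typeset) j

theorem apply_mem_typeset {g : U ≃[L] U} (hg : g ∈ stab L 𝓑.sockel) {x : U}
    (hx : x ∈ 𝓑.typeset) : g x ∈ 𝓑.typeset := by
  obtain ⟨j, hj⟩ := Set.mem_iUnion.1 hx
  exact 𝓑.typeset_type_subset j (𝓑.apply_mem_typeset_type hg hj)

theorem disjoint_typeset_sockel : Disjoint 𝓑.typeset (𝓑.sockel : Set U) := by
  refine Set.disjoint_iUnion_left.2 fun j => ?_
  rw [← 𝓑.sockel_type j]
  exact (𝓑.type j).disjoint_typeset_sockel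

variable {𝓑}

theorem IsEmbedding.exists_apply_eq {f : 𝓑.domain → 𝓑.domain} (hf : 𝓑.IsEmbedding f)
    (x : 𝓑.domain) : ∃ g ∈ stab L 𝓑.sockel, g (x : U) = f x := by
  obtain ⟨g, hg, h⟩ := hf {x}
  exact ⟨g, hg, h x (Finset.mem_singleton_self x)⟩

theorem IsEmbedding.apply_mem_typeset_type_iff {f : 𝓑.domain → 𝓑.domain} (hf : 𝓑.IsEmbedding f)
    (x : 𝓑.domain) (j : Fin n) :
    (f x : U) ∈ (𝓑.type j).typeset ↔ (x : U) ∈ (𝓑.type j).typeset := by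
  obtain ⟨g, hg, h⟩ := hf.exists_apply_eq x
  rw [← h]
  exact ⟨𝓑.mem_typeset_type_of_apply_mem hg, 𝓑.apply_mem_typeset_type hg⟩

theorem isEmbedding_id : 𝓑.IsEmbedding id := fun _ =>
  ⟨Language.Equiv.refl L U, fun _ _ => rfl, fun _ _ => rfl⟩

theorem IsEmbedding.comp {f h : 𝓑.domain → 𝓑.domain} (hf : 𝓑.IsEmbedding f)
    (hh : 𝓑.IsEmbedding h) : 𝓑.IsEmbedding (f ∘ h) := by
  classical
  intro A
  obtain ⟨g₁, hg₁, h₁⟩ := hh A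
  obtain ⟨g₂, hg₂, h₂⟩ := hf (A.image h)
  refine ⟨g₂.comp g₁, fun a ha => ?_, fun a ha => ?_⟩
  · rw [Language.Equiv.comp_apply, hg₁ a ha, hg₂ a ha]
  · rw [Language.Equiv.comp_apply, h₁ a ha, h₂ _ (Finset.mem_image_of_mem h ha)]
    rfl

/-- A limit on `σ(𝓑)` of elements of `G_{ι(𝓑)}` extends to an embedding of `𝓑`. -/
theorem exists_isEmbedding {f : U → U} (hf : ∀ A : Set U, A.Finite → A ⊆ 𝓑.typeset →
    ∃ g : U ≃[L] U, (∀ a ∈ (𝓑.sockel : Set U), g a = a) ∧ ∀ a ∈ A, g a = f a) :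
    ∃ h : 𝓑.domain → 𝓑.domain, 𝓑.IsEmbedding h ∧
      ∀ x : 𝓑.domain, (x : U) ∈ 𝓑.typeset → (h x : U) = f x := by
  classical
  have hmem : ∀ x ∈ 𝓑.typeset, f x ∈ 𝓑.typeset := by
    intro x hx
    obtain ⟨g, hg, h⟩ := hf {x} (Set.finite_singleton x) (Set.singleton_subset_iff.2 hx)
    rw [← h x rfl]
    exact 𝓑.apply_mem_typeset hg hx
  -- The values of f on the sockel are arbitrary, so they are replaced by the identity.
  refine ⟨fun x => if hx : (x : U) ∈ 𝓑.typeset then ⟨f x, Or.inr (hmem x hx)⟩ else x,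
    fun A => ?_, fun x hx => by simp [hx]⟩
  obtain ⟨g, hg, h⟩ := hf ((↑) '' (A : Set 𝓑.domain) ∩ 𝓑.typeset)
    ((A.finite_toSet.image _).inter_of_left _) Set.inter_subset_right
  refine ⟨g, hg, fun a ha => ?_⟩
  by_cases hx : (a : U) ∈ 𝓑.typeset
  · simpa [hx] using h a ⟨⟨a, ha, rfl⟩, hx⟩
  · simpa [hx] using hg a (a.2.resolve_right hx)

theorem isWeaklyIndivisible [L.IsRelational] [Countable U]
    (hU : IsFreeAmalgamationHomogeneous L U) (𝓑 : TypeBundle L U n) : 𝓑.IsWeaklyIndivisible := by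
  classical
  intro P hP
  let Mono : Set (Fin n) → Prop := fun J => ∃ (ε' : Fin n → Fin 2) (f : 𝓑.domain → 𝓑.domain),
    𝓑.IsEmbedding f ∧ ∀ j ∈ J, ∀ x : 𝓑.domain, (x : U) ∈ (𝓑.type j).typeset →
      (f x : U) ∈ P (ε' j) j
  obtain ⟨J, ⟨ε', f, hf, hfJ⟩, hmax⟩ := Set.Finite.exists_maximal (Set.toFinite {J | Mono J})
    ⟨∅, fun _ => 0, id, isEmbedding_id, by simp⟩
  refine ⟨J, ε', _, ⟨f, hf, rfl⟩, ?_, fun ε hε => ?_⟩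
  · rintro j hj _ ⟨⟨x, rfl⟩, hx⟩
    exact hfJ j hj x ((hf.apply_mem_typeset_type_iff x j).1 hx)
  refine Set.Subset.antisymm (fun A hA => ⟨hA.1, Language.Equiv.refl L U, fun _ _ => rfl, hA.1⟩) ?_
  rintro A ⟨hAV, -⟩
  have hdisj := 𝓑.disjoint_typeset_sockel
  obtain ⟨g, hg, hgA⟩ := exists_equiv_of_blocking hU 𝓑.sockel.finite_toSet A.finite_toSet
    (hdisj.mono_left hAV)
    (fun _ y => ∃ h : y ∈ 𝓑.domain, (f ⟨y, h⟩ : U) ∈ colourUnion P ε) (by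
      intro a ha E hE hEF
      obtain ⟨j, haj⟩ := Set.mem_iUnion.1 (hAV ha)
      by_cases hj : j ∈ J
      -- For j ∈ J nothing needs blocking: f already gives every point of σ(B_j) the colour ε j.
      · refine ⟨∅, Set.finite_empty, by simp, ⟨by simp, ?_⟩, Language.Equiv.refl L U,
          fun _ _ => rfl, by simp, fun k hk _ _ => ?_⟩
        · rintro k R z - - ⟨i, hi⟩
          exact hi.elim
        · have hka := 𝓑.apply_mem_typeset_type hk haj
          refine ⟨Or.inr (𝓑.typeset_type_subset j hka), Set.mem_iUnion.2 ⟨j, ?_⟩⟩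
          rw [hε j hj]
          exact hfJ j hj _ hka
      · obtain ⟨D, hD, hDF, hDE, x, hx, m, hm, hmD, h⟩ := exists_blocking hU
          𝓑.sockel.finite_toSet hdisj (fun g hg x hx => 𝓑.apply_mem_typeset hg hx)
          (𝓑.typeset_type_subset j)
          (fun y => ∃ h : y ∈ 𝓑.domain, (f ⟨y, h⟩ : U) ∈ P (ε j) j) (by
            rintro ⟨f₁, hf₁, hf₁j⟩
            obtain ⟨h, hh, hhf⟩ := exists_isEmbedding hf₁
            -- Avoiding ε j means having the other colour, which in `Fin 2` is ε j + 1; this would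
            -- enlarge J.
            refine hj (hmax (y := insert j J) ⟨Function.update ε' j (ε j + 1), f ∘ h, hf.comp hh, ?_⟩
              (Set.subset_insert j J) (Set.mem_insert j J))
            intro i hi y hy
            have hfy := (hh.apply_mem_typeset_type_iff y i).2 hy
            by_cases hij : i = j
            · subst hij
              rw [Function.update_self]
              have hcol := (hf.apply_mem_typeset_type_iff (h y) i).2 hfy
              rw [← hP.cover i] at hcol
              obtain ⟨c, hc⟩ := Set.mem_iUnion.1 hcol
              have hne : c ≠ ε i := by
                rintro rfl
                refine hf₁j y hy ?_
                rw [← hhf y (𝓑.typeset_type_subset i hy)]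
                exact ⟨(h y).2, hc⟩
              have : c = ε i + 1 := by
                have key : ∀ c e : Fin 2, c ≠ e → c = e + 1 := by decide
                exact key c _ hne
              exact this ▸ hc
            · rw [Function.update_of_ne hij]
              exact hfJ i (hi.resolve_left hij) (h y) hfy) hE hEF
        -- The blocked point x and the given a lie in one orbit, so the blocking type serves for a
        -- as well.
        obtain ⟨l, hl, rfl⟩ := (𝓑.type j).exists_apply_eq haj hx
        rw [𝓑.sockel_type] at hl
        refine ⟨D, hD, hDF, hDE, m.comp l, fun y hy => ?_, hmD, fun k hkF hkD hk => ?_⟩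
        · rw [Language.Equiv.comp_apply, hl y hy, hm y hy]
        · obtain ⟨h1, h2⟩ := h k hkF hkD hk
          exact ⟨h1, Set.mem_iUnion.2 ⟨j, h2⟩⟩)
  choose hdom hcol using hgA
  -- On the finite set g[A] the embedding f is an element g' of the stabilizer, so g' ∘ g moves A
  -- into the copy with the prescribed colours.
  obtain ⟨g', hg', h⟩ := hf (A.attach.image fun a : A => (⟨g a, hdom a a.2⟩ : 𝓑.domain))
  refine ⟨hAV, g'.comp g, fun a ha => ?_, fun a ha => ?_⟩
  · rw [Language.Equiv.comp_apply, hg a ha, hg' a ha]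
  · have := h ⟨g a, hdom a ha⟩ (Finset.mem_image.2 ⟨⟨a, ha⟩, Finset.mem_attach _ _, rfl⟩)
    rw [Language.Equiv.comp_apply]
    change g' (g a) = _ at this
    rw [this]
    exact ⟨hcol a ha, _, rfl⟩

end TypeBundle

end FreeAmalgamation

theorem theorem9p1 {L : FirstOrder.Language.{u, v}} [L.IsRelational] {U : Type w}
    [L.Structure U] [Countable U]
    (hU : FreeAmalgamation.IsFreeAmalgamationHomogeneous L U)
    {n : ℕ} (𝓑 : FreeAmalgamation.TypeBundle L U n) :
    𝓑.IsWeaklyIndivisible :=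
  FreeAmalgamation.TypeBundle.isWeaklyIndivisible hU 𝓑
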